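/- Let $K$ be an algebraically closed field of characteristic $0$, let $v_0\ge 1$ be an integer, and let $f=1+\sum_{v\ge v_0}p_v x^v\in K[[x]]$ with $p_{v_0}=1$. Let $g\in K[[x]]$ be the quotient $g=f(f^{v_0}-1)/f'$, that is, the unique power series with $g f'=f(f^{v_0}-1)$, and let $G\in K[[x]][[y]]$ be the unique series such that $G(x,0)=x$ and $$G_y(x,y)=g(x)f'(y)\,G_x(x,y)-(f(y)-1)\,G_y(x,y),$$ where $G_x,G_y$ are the formal partial derivatives. Define a family $(\mathfrak p_{uv}^w)_{u,v,w\in\mathbb N_0}$ in $K$ by $\mathfrak p_{uv}^0=\delta_{0,u+v}$, by $G(x,y)=\sum_{u,v\ge 0}\mathfrak p_{uv}^1x^uy^v$, and recursively, for $w>1$, by $$\mathfrak p_{uv}^w=\sum_{\substack{u_1+u_2=u\\ v_1+v_2=v}}\mathfrak p_{u_1v_1}^1\,\mathfrak p_{u_2v_2}^{w-1}.$$ Then for all $i,j,k\in\mathbb N_0$ the equation $E_{ijk}$ holds: $$\sum_{a+b=j}\sum_{h=0}^i\sum_{l=0}^k\mathfrak p_{ia}^h\,\mathfrak p_{kb}^l\,\mathfrak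 p_{hl}^1=\sum_{c+d=k}\sum_{h=0}^i\sum_{l=0}^j\mathfrak p_{ic}^h\,\mathfrak p_{jd}^l\,\mathfrak p_{hl}^1 .$$ Equivalently, $R(i,j,k)=R(i,k,j)$, where $R(i,j,k)$ denotes the left-hand side. -/

import Mathlib

open PowerSeries Finset

namespace StdCycle

variable {K : Type*} [Field K]

/-- `v₀ > 0` and `f = 1 + ∑_{v ≥ v₀} p_v x^v ∈ K[[x]]` with `p_{v₀} = 1`. -/
structure IsAdmissible (v₀ : ℕ) (f : K⟦X⟧) : Prop where
  pos : 0 < v₀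
  coeff_zero : coeff 0 f = 1
  coeff_lt : ∀ v, 0 < v → v < v₀ → coeff v f = 0
  coeff_eq : coeff v₀ f = 1

/-- `g` is the quotient `f (f^{v₀} - 1) / f'` in `K[[x]]`. -/
def IsQuotient (v₀ : ℕ) (f g : K⟦X⟧) : Prop :=
  g * d⁄dX K f = f * (f ^ v₀ - 1)

/-- The series `h(y)` seen in `K[[x]][[y]]`. -/
noncomputable def inY (h : K⟦X⟧) : K⟦X⟧⟦X⟧ := PowerSeries.map (C : K →+* K⟦X⟧) h

/-- The series `h(x)` seen in `K[[x]][[y]]`. -/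
noncomputable def inX (h : K⟦X⟧) : K⟦X⟧⟦X⟧ := C h

/-- The formal partial derivative `G_x` of `G ∈ K[[x]][[y]]`. -/
noncomputable def partialX (G : K⟦X⟧⟦X⟧) : K⟦X⟧⟦X⟧ :=
  PowerSeries.mk fun v => d⁄dX K (coeff v G)

/-- The formal partial derivative `G_y` of `G ∈ K[[x]][[y]]`. -/
noncomputable def partialY (G : K⟦X⟧⟦X⟧) : K⟦X⟧⟦X⟧ := d⁄dX (K⟦X⟧) G

/-- `G(x, 0) = x` and `G_y = g(x) f'(y) G_x - (f(y) - 1) G_y`. -/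
structure IsSolution (f g : K⟦X⟧) (G : K⟦X⟧⟦X⟧) : Prop where
  initial : coeff 0 G = X
  pde : partialY G =
    inX g * inY (d⁄dX K f) * partialX G - inY (f - 1) * partialY G

theorem IsAdmissible.exists_factor {v₀ : ℕ} {f : K⟦X⟧} (h : IsAdmissible v₀ f) :
    ∃ u : K⟦X⟧, constantCoeff u = 1 ∧ f = 1 + X ^ v₀ * u := by
  have hd : (X : K⟦X⟧) ^ v₀ ∣ f - 1 := by
    rw [X_pow_dvd_iff]
    intro m hm
    rcases Nat.eq_zero_or_pos m with rfl | hm0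
    · rw [map_sub, h.coeff_zero]; simp
    · rw [map_sub, h.coeff_lt m hm0 hm, coeff_one, if_neg hm0.ne', sub_zero]
  obtain ⟨u, hu⟩ := hd
  have hf : f = 1 + X ^ v₀ * u := by rw [← hu]; ring
  refine ⟨u, ?_, hf⟩
  have h1 := h.coeff_eq
  rw [hf, map_add, coeff_one, if_neg h.pos.ne', zero_add] at h1
  have h2 := coeff_X_pow_mul u v₀ 0
  rw [zero_add, h1] at h2
  rw [← coeff_zero_eq_constantCoeff_apply, ← h2]

/-- The quotient `f (f^{v₀} - 1) / f'` exists in `K[[x]]` and is unique. -/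
theorem IsAdmissible.existsUnique_quotient [CharZero K] {v₀ : ℕ} {f : K⟦X⟧}
    (h : IsAdmissible v₀ f) : ∃! g : K⟦X⟧, IsQuotient v₀ f g := by
  obtain ⟨u, hu, hf⟩ := h.exists_factor
  obtain ⟨n, rfl⟩ : ∃ n, v₀ = n + 1 := ⟨v₀ - 1, by have := h.pos; omega⟩
  set w : K⟦X⟧ := ((n + 1 : ℕ) : K⟦X⟧) * u + X * d⁄dX K u with hw
  have hder : d⁄dX K f = X ^ n * w := by
    rw [hf, map_add, Derivation.leibniz, Derivation.leibniz_pow]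
    simp only [Derivation.map_one_eq_zero, smul_eq_mul, nsmul_eq_mul, hw,
      PowerSeries.derivative_X, Nat.add_sub_cancel]
    ring
  have hw0 : constantCoeff w ≠ 0 := by
    rw [hw]
    simp only [map_add, map_mul, map_natCast, hu, constantCoeff_X, zero_mul, add_zero, mul_one]
    exact_mod_cast Nat.succ_ne_zero n
  have hdne : d⁄dX K f ≠ 0 := by
    rw [hder]
    refine mul_ne_zero (pow_ne_zero _ X_ne_zero) ?_
    intro h0
    rw [h0] at hw0
    simp at hw0
  have hdvd : d⁄dX K f ∣ f * (f ^ (n + 1) - 1) := by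
    have h1 : f - 1 ∣ f ^ (n + 1) - 1 := by
      simpa using sub_dvd_pow_sub_pow f 1 (n + 1)
    have h2 : X ^ n ∣ f - 1 := ⟨X * u, by rw [hf]; ring⟩
    have h3 : d⁄dX K f ∣ X ^ n := ⟨w⁻¹, by
      rw [hder, mul_assoc, PowerSeries.mul_inv_cancel _ hw0, mul_one]⟩
    exact ((h3.trans h2).trans h1).mul_left f
  obtain ⟨g, hg⟩ := hdvd
  refine ⟨g, ?_, ?_⟩
  · change g * _ = _
    rw [hg, mul_comm]
  · intro g' hg'
    have hg'' : g' * d⁄dX K f = g * d⁄dX K f := by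
      rw [show g' * d⁄dX K f = _ from hg', hg, mul_comm]
    exact mul_right_cancel₀ hdne hg''

/-- Solving a linear equation `G_y = F G_x`, `G(x, 0) = x` degree by degree. -/
noncomputable def solCoeff (F : K⟦X⟧⟦X⟧) : ℕ → K⟦X⟧
  | 0 => X
  | v + 1 => C ((v + 1 : K)⁻¹) *
      ∑ b : Fin (v + 1), coeff (v - b) F * d⁄dX K (solCoeff F b)
decreasing_by exact b.2

theorem existsUnique_linear [CharZero K] (F : K⟦X⟧⟦X⟧) :
    ∃! G : K⟦X⟧⟦X⟧, coeff 0 G = X ∧ partialY G = F * partialX G := by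
  have key : ∀ G : K⟦X⟧⟦X⟧, partialY G = F * partialX G ↔
      ∀ v : ℕ, coeff (v + 1) G = C ((v + 1 : K)⁻¹) *
        ∑ b : Fin (v + 1), coeff (v - b) F * d⁄dX K (coeff b G) := by
    intro G
    rw [PowerSeries.ext_iff]
    refine forall_congr' fun v => ?_
    have hv : (v + 1 : K) ≠ 0 := by exact_mod_cast Nat.succ_ne_zero v
    have e1 : coeff v (partialY G) = coeff (v + 1) G * C (v + 1 : K) := by
      simp [partialY, coeff_derivative]
    have e2 : coeff v (F * partialX G) =
        ∑ b : Fin (v + 1), coeff (v - b) F * d⁄dX K (coeff b G) := by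
      rw [mul_comm, coeff_mul, Nat.sum_antidiagonal_eq_sum_range_succ_mk,
        ← Fin.sum_univ_eq_sum_range (fun k => coeff k (partialX G) * coeff (v - k) F)]
      refine Finset.sum_congr rfl fun b _ => ?_
      rw [partialX, coeff_mk, mul_comm]
    rw [e1, e2]
    have hc : (C (v + 1 : K) : K⟦X⟧) * C ((v + 1 : K)⁻¹) = 1 := by
      rw [← map_mul, mul_inv_cancel₀ hv, map_one]
    constructor
    · intro h
      rw [← h, mul_comm, mul_assoc, hc, mul_one]
    · intro h
      rw [h, mul_comm, ← mul_assoc, hc, one_mul]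
  refine ⟨PowerSeries.mk (solCoeff F), ⟨?_, (key _).2 fun v => ?_⟩, ?_⟩
  · rw [coeff_mk, solCoeff]
  · simp only [coeff_mk]
    rw [solCoeff]
  · rintro G ⟨h0, h1⟩
    have h2 := (key G).1 h1
    ext1 v
    rw [coeff_mk]
    induction v using Nat.strong_induction_on with
    | _ v ih =>
      cases v with
      | zero => rw [h0, solCoeff]
      | succ v =>
        rw [h2 v, solCoeff]
        congr 1
        refine Finset.sum_congr rfl fun b _ => ?_
        rw [ih b b.2]

/-- The equation for `G` has exactly one solution in `K[[x]][[y]]`. -/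
theorem IsAdmissible.existsUnique_solution [CharZero K] {v₀ : ℕ} {f : K⟦X⟧}
    (h : IsAdmissible v₀ f) (g : K⟦X⟧) : ∃! G : K⟦X⟧⟦X⟧, IsSolution f g G := by
  have hf : constantCoeff f ≠ 0 := by
    rw [← coeff_zero_eq_constantCoeff_apply, h.coeff_zero]; exact one_ne_zero
  have hu : inY f * inY f⁻¹ = 1 := by
    rw [inY, inY, ← map_mul, PowerSeries.mul_inv_cancel _ hf, map_one]
  have hs : inY (f - 1) = inY f - 1 := by simp [inY]
  have hiff : ∀ G : K⟦X⟧⟦X⟧, IsSolution f g G ↔ coeff 0 G = X ∧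
      partialY G = (inY f⁻¹ * (inX g * inY (d⁄dX K f))) * partialX G := by
    intro G
    constructor
    · rintro ⟨h0, h1⟩
      refine ⟨h0, ?_⟩
      rw [hs] at h1
      linear_combination inY f⁻¹ * h1 - partialY G * hu
    · rintro ⟨h0, h1⟩
      refine ⟨h0, ?_⟩
      rw [hs]
      linear_combination inY f * h1 + (inX g * inY (d⁄dX K f) * partialX G) * hu
  simp only [hiff]
  exact existsUnique_linear _

/-- The series `g = f (f^{v₀} - 1) / f' ∈ K[[x]]`. -/
noncomputable def gSeries [CharZero K] {v₀ : ℕ} {f : K⟦X⟧} (h : IsAdmissible v₀ f) : K⟦X⟧ :=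
  h.existsUnique_quotient.choose

/-- The series `G ∈ K[[x]][[y]]` with `G(x, 0) = x` and
`G_y = g(x) f'(y) G_x - (f(y) - 1) G_y`. -/
noncomputable def GSeries [CharZero K] {v₀ : ℕ} {f : K⟦X⟧} (h : IsAdmissible v₀ f) : K⟦X⟧⟦X⟧ :=
  (h.existsUnique_solution (gSeries h)).choose

theorem gSeries_spec [CharZero K] {v₀ : ℕ} {f : K⟦X⟧} (h : IsAdmissible v₀ f) :
    IsQuotient v₀ f (gSeries h) :=
  h.existsUnique_quotient.choose_spec.1

theorem GSeries_spec [CharZero K] {v₀ : ℕ} {f : K⟦X⟧} (h : IsAdmissible v₀ f) :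
    IsSolution f (gSeries h) (GSeries h) :=
  (h.existsUnique_solution (gSeries h)).choose_spec.1

/-- The family `p_{uv}^w` attached to `G`, written `pCoeff G w u v`: `p_{uv}^0 = δ_{0,u+v}`,
`p_{uv}^1` is the coefficient of `x^u y^v` in `G`, and for `w > 1`
`p_{uv}^w = ∑ p_{u₁v₁}^1 p_{u₂v₂}^{w-1}` over `u₁ + u₂ = u`, `v₁ + v₂ = v`. -/
noncomputable def pCoeff (G : K⟦X⟧⟦X⟧) : ℕ → ℕ → ℕ → K
  | 0, u, v => if u + v = 0 then 1 else 0
  | 1, u, v => coeff u (coeff v G)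
  | w + 2, u, v => ∑ a ∈ antidiagonal u, ∑ c ∈ antidiagonal v,
      coeff a.1 (coeff c.1 G) * pCoeff G (w + 1) a.2 c.2

/-- The equation `E_{ijk}` for a family `P w u v = X_{uv}^w`:
`∑_{a+b=j} ∑_{h≤i} ∑_{l≤k} X_{ia}^h X_{kb}^l X_{hl}^1
  = ∑_{c+d=k} ∑_{h≤i} ∑_{l≤j} X_{ic}^h X_{jd}^l X_{hl}^1`. -/
def BraidEquation (P : ℕ → ℕ → ℕ → K) (i j k : ℕ) : Prop :=
  ∑ ab ∈ antidiagonal j, ∑ h ∈ range (i + 1), ∑ l ∈ range (k + 1),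
      P h i ab.1 * P l k ab.2 * P 1 h l =
    ∑ cd ∈ antidiagonal k, ∑ h ∈ range (i + 1), ∑ l ∈ range (j + 1),
      P h i cd.1 * P l j cd.2 * P 1 h l

end StdCycle

/-! Put `Q = f⁻ᵛ - 1` with `v = v₀`. The definition of `g` turns into the linear equation `g Q' = v
Q`. Hence `Q(G(x, y))` and `f(y)ᵛ Q(x)` both solve `f(y) F_y = g(x) f'(y) F_x` and agree at `y = 0`.
Such a solution is determined by its value at `y = 0`, so `Q(G(x, y)) = f(y)ᵛ Q(x)`
(`IsSolution.subst_toMv`).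

Since `fᵛ = 1 / (1 + Q)`, applying this rule repeatedly gives `Q(G(G(x, y), G(z, y))) = Q(x) / (1 +
Q(y) + Q(z))`, which is symmetric in `y` and `z`. The series `Q` is `Xᵛ` times a unit, so it
determines its argument only up to a `v`-th root of unity. That ambiguity disappears because both
iterates have the form `x * (1 + ...)` (`eq_of_subst_eq`). Therefore `G(G(x, y), G(z, y)) = G(G(x,
z), G(y, z))`.

Finally, `p_{uv}^w` is the coefficient of `x^u y^v` in `G^w`, and `x` divides `G`. So the two sides
of `E_{ijk}` are the coefficients of `x^i y^j z^k` in the two members of this identity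
(`coeff_subst_subst`). -/

namespace StdCycle

/-! ### Substitution in power series: chain rule, divisibility, uniqueness -/

section General

variable {K : Type*} [Field K] {σ τ : Type*}

theorem coeff_pow_eq_zero_of_degree_lt {a : MvPowerSeries σ K}
    (ha : MvPowerSeries.constantCoeff a = 0) {e : σ →₀ ℕ} {n : ℕ} (h : e.degree < n) :
    MvPowerSeries.coeff e (a ^ n) = 0 :=
  MvPowerSeries.coeff_of_lt_order <|
    lt_of_lt_of_le (by exact_mod_cast h) (MvPowerSeries.le_order_pow_of_constantCoeff_eq_zero n ha)

/-- The chain rule for the substitution of a multivariate series in a univariate one. -/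
theorem pderiv_subst (i : σ) (ψ : K⟦X⟧) {a : MvPowerSeries σ K}
    (ha : MvPowerSeries.constantCoeff a = 0) :
    MvPowerSeries.pderiv K i (ψ.subst a) =
      (d⁄dX K ψ).subst a * MvPowerSeries.pderiv K i a := by
  classical
  have hs : HasSubst a := HasSubst.of_constantCoeff_zero ha
  have hpoly : ∀ p : Polynomial K, MvPowerSeries.pderiv K i ((p : K⟦X⟧).subst a) =
      (d⁄dX K (p : K⟦X⟧)).subst a * MvPowerSeries.pderiv K i a := by
    intro p
    simp [subst_coe hs, derivative_coe,
      Derivation.comp_aeval_eq (a := a) (MvPowerSeries.pderiv K i) p, smul_eq_mul]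
  -- As `a ^ d` has order at least `d`, the coefficient at `e` only sees the terms of `φ` of degree
  -- at most `e.degree`. This reduces the chain rule to polynomials.
  have htrunc : ∀ (φ : K⟦X⟧) (e : σ →₀ ℕ) (m : ℕ), e.degree < m →
      MvPowerSeries.coeff e (φ.subst a) =
        MvPowerSeries.coeff e ((trunc m φ : K⟦X⟧).subst a) := by
    intro φ e m hm
    rw [coeff_subst hs, coeff_subst hs]
    refine finsum_congr fun d => ?_
    obtain hd | hd := lt_or_ge d m
    · rw [Polynomial.coeff_coe, coeff_trunc, if_pos hd]
    · rw [coeff_pow_eq_zero_of_degree_lt ha (hm.trans_le hd), smul_zero, smul_zero]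
  ext e
  -- Differentiation costs one degree in the exponent and one in the truncation, hence the cut at
  -- `e.degree + 2`.
  have h1 : (e + Finsupp.single i 1).degree < e.degree + 1 + 1 := by simp
  rw [MvPowerSeries.coeff_pderiv, htrunc ψ _ _ h1, ← MvPowerSeries.coeff_pderiv, hpoly,
    MvPowerSeries.coeff_mul, MvPowerSeries.coeff_mul]
  refine Finset.sum_congr rfl fun x hx => ?_
  have hle : x.1.degree < e.degree + 1 := by
    rw [← mem_antidiagonal.1 hx]; simp
  rw [htrunc (d⁄dX K ψ) x.1 _ hle, derivative_coe, trunc_derivative]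

theorem coeff_X_mul_of_eq_zero {s : σ} {e : σ →₀ ℕ} (h : e s = 0) (W : MvPowerSeries σ K) :
    MvPowerSeries.coeff e (MvPowerSeries.X s * W) = 0 :=
  MvPowerSeries.X_dvd_iff.1 (Dvd.intro _ rfl) e h

theorem coeff_add_single_X_mul (s : σ) (e : σ →₀ ℕ) (W : MvPowerSeries σ K) :
    MvPowerSeries.coeff (e + Finsupp.single s 1) (MvPowerSeries.X s * W) =
      MvPowerSeries.coeff e W := by
  rw [MvPowerSeries.X, add_comm, MvPowerSeries.coeff_add_monomial_mul, one_mul]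

/-- `a - b` divides `ψ(a) - ψ(b)`. -/
theorem sub_dvd_subst_sub_subst (ψ : K⟦X⟧) {a b : MvPowerSeries τ K}
    (ha : MvPowerSeries.constantCoeff a = 0) (hb : MvPowerSeries.constantCoeff b = 0) :
    a - b ∣ ψ.subst a - ψ.subst b := by
  -- Universal case: `(x^n - y^n) / (x - y)` is the sum of all `x^a y^b` with `a + b + 1 = n`.
  -- Substituting `a`, `b` for the variables then gives the general case.
  let W : MvPowerSeries (Fin 2) K := fun d => coeff (d 0 + d 1 + 1) ψ
  have hW : ∀ d, MvPowerSeries.coeff d W = coeff (d 0 + d 1 + 1) ψ := fun _ => rfl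
  have key : (ψ.subst (MvPowerSeries.X 0 : MvPowerSeries (Fin 2) K)) -
      ψ.subst (MvPowerSeries.X 1 : MvPowerSeries (Fin 2) K) =
      (MvPowerSeries.X 0 - MvPowerSeries.X 1) * W := by
    have hx : ∀ (s : Fin 2) (d : Fin 2 →₀ ℕ), MvPowerSeries.coeff d (MvPowerSeries.X s * W) =
        if d s = 0 then 0 else coeff (d 0 + d 1) ψ := by
      intro s d
      split_ifs with h
      · exact coeff_X_mul_of_eq_zero h W
      · obtain ⟨e, rfl⟩ : ∃ e, d = e + Finsupp.single s 1 :=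
          ⟨d - Finsupp.single s 1, (tsub_add_cancel_of_le (by
            rw [Finsupp.single_le_iff]; omega)).symm⟩
        rw [coeff_add_single_X_mul, hW]
        clear h
        refine congrArg (fun m => coeff m ψ) ?_
        fin_cases s
        · simp; omega
        · simp; omega
    ext d
    rw [map_sub, coeff_subst_single, coeff_subst_single, sub_mul, map_sub, hx, hx]
    have e0 : d = Finsupp.single 0 (d 0) ↔ d 1 = 0 := by
      simp [Finsupp.ext_iff, Fin.forall_fin_two]
    have e1 : d = Finsupp.single 1 (d 1) ↔ d 0 = 0 := by
      simp [Finsupp.ext_iff, Fin.forall_fin_two]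
    simp only [e0, e1]
    by_cases h0 : d 0 = 0 <;> by_cases h1 : d 1 = 0 <;> simp [h0, h1]
  have hab : MvPowerSeries.HasSubst ![a, b] :=
    MvPowerSeries.hasSubst_of_constantCoeff_zero fun s => by fin_cases s <;> simp [ha, hb]
  have hc : ∀ s, (ψ.subst (MvPowerSeries.X s : MvPowerSeries (Fin 2) K)).subst ![a, b] =
      ψ.subst (![a, b] s) := by
    intro s
    rw [PowerSeries.subst, MvPowerSeries.subst_comp_subst_apply (HasSubst.X s).const hab]
    simp [PowerSeries.subst, MvPowerSeries.subst_X hab]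
  have := congrArg (MvPowerSeries.subst ![a, b]) key
  rw [MvPowerSeries.subst_sub hab, hc, hc, MvPowerSeries.subst_mul hab,
    MvPowerSeries.subst_sub hab, MvPowerSeries.subst_X hab, MvPowerSeries.subst_X hab] at this
  exact ⟨_, this⟩

theorem constantCoeff_subst_eq [Finite σ] {a : σ → MvPowerSeries τ K}
    (ha : ∀ s, MvPowerSeries.constantCoeff (a s) = 0) (H : MvPowerSeries σ K) :
    MvPowerSeries.constantCoeff (H.subst a) = MvPowerSeries.constantCoeff H := by
  have hs := MvPowerSeries.hasSubst_of_constantCoeff_zero ha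
  have h := MvPowerSeries.constantCoeff_subst_eq_zero hs ha
    (f := H - MvPowerSeries.C (MvPowerSeries.constantCoeff H)) (by simp)
  rw [MvPowerSeries.subst_sub hs, MvPowerSeries.subst_C, map_sub,
    MvPowerSeries.constantCoeff_C, sub_eq_zero] at h
  exact h

theorem constantCoeff_powerSeries_subst {a : MvPowerSeries τ K}
    (ha : MvPowerSeries.constantCoeff a = 0) (ψ : K⟦X⟧) :
    MvPowerSeries.constantCoeff (ψ.subst a) = constantCoeff ψ :=
  constantCoeff_subst_eq (fun _ => ha) ψ

/-- Series `X s * A`, `X s * B` with the same value under `X ^ n * U`, where `U` is a unit and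
`A`, `B` have constant coefficient `1`, agree. -/
theorem eq_of_subst_eq [CharZero K] {n : ℕ} (hn : n ≠ 0) {U : K⟦X⟧} (hU : constantCoeff U ≠ 0)
    (s : σ) {A B : MvPowerSeries σ K} (hA : MvPowerSeries.constantCoeff A = 1)
    (hB : MvPowerSeries.constantCoeff B = 1)
    (h : (X ^ n * U).subst (MvPowerSeries.X s * A) = (X ^ n * U).subst (MvPowerSeries.X s * B)) :
    A = B := by
  have ha : MvPowerSeries.constantCoeff (MvPowerSeries.X s * A) = 0 := by simp
  have hb : MvPowerSeries.constantCoeff (MvPowerSeries.X s * B) = 0 := by simp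
  have ha' := HasSubst.of_constantCoeff_zero ha
  have hb' := HasSubst.of_constantCoeff_zero hb
  rw [subst_mul ha', subst_mul hb', subst_pow ha', subst_pow hb', subst_X ha', subst_X hb'] at h
  obtain ⟨W, hW⟩ := sub_dvd_subst_sub_subst U ha hb
  have hS := geom_sum₂_mul A B n
  set S := ∑ i ∈ range n, A ^ i * B ^ (n - 1 - i) with hSdef
  have hX : (MvPowerSeries.X s : MvPowerSeries σ K) ^ n ≠ 0 := by
    rw [MvPowerSeries.X_pow_eq]
    intro h0
    have := congrArg (MvPowerSeries.coeff (Finsupp.single s n)) h0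
    simp at this
  -- Here `A^n U(XA) - B^n U(XB)` is split as `(A^n - B^n) U(XA) + B^n (U(XA) - U(XB))`, and `A - B`
  -- is taken out of both terms. The cofactor has constant coefficient `n U(0) ≠ 0`.
  have h0 : (A - B) * (S * U.subst (MvPowerSeries.X s * A) + B ^ n * (MvPowerSeries.X s * W)) =
      0 := by
    refine (mul_eq_zero.1 (?_ : MvPowerSeries.X s ^ n * _ = 0)).resolve_left hX
    linear_combination h + MvPowerSeries.X s ^ n * U.subst (MvPowerSeries.X s * A) * hS -
      MvPowerSeries.X s ^ n * B ^ n * hW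
  rcases mul_eq_zero.1 h0 with h1 | h1
  · exact sub_eq_zero.1 h1
  · exfalso
    have h2 := congrArg MvPowerSeries.constantCoeff h1
    have hSc : MvPowerSeries.constantCoeff S = (n : K) := by
      simp [hSdef, map_sum, hA, hB]
    rw [map_add, map_mul, hSc, constantCoeff_powerSeries_subst ha] at h2
    simp [hn, hU] at h2

/-- A solution of `c F_t = b F_s` with `F = 0` at `t = 0` vanishes if `c` is a unit. -/
theorem eq_zero_of_pderiv_eq [CharZero K] {s t : σ} (hst : s ≠ t) {F b c : MvPowerSeries σ K}
    (hc : MvPowerSeries.constantCoeff c ≠ 0)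
    (hF : c * MvPowerSeries.pderiv K t F = b * MvPowerSeries.pderiv K s F)
    (h0 : MvPowerSeries.X t ∣ F) : F = 0 := by
  classical
  -- If `t^(n+1)` divides `F`, it divides `F_s` because `s ≠ t`, hence also `F_t` because `c` is a
  -- unit. Integration in characteristic zero gains one more power of `t`.
  have hdvd : ∀ n, (MvPowerSeries.X t : MvPowerSeries σ K) ^ (n + 1) ∣ F := by
    intro n
    induction n with
    | zero => simpa using h0
    | succ n ih =>
      have h1 : (MvPowerSeries.X t : MvPowerSeries σ K) ^ (n + 1) ∣ MvPowerSeries.pderiv K s F := by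
        rw [MvPowerSeries.X_pow_dvd_iff] at ih ⊢
        intro m hm
        rw [MvPowerSeries.coeff_pderiv, ih, zero_mul]
        simpa [Finsupp.single_eq_of_ne hst.symm] using hm
      have h2 : (MvPowerSeries.X t : MvPowerSeries σ K) ^ (n + 1) ∣ MvPowerSeries.pderiv K t F := by
        have : MvPowerSeries.pderiv K t F = c⁻¹ * (b * MvPowerSeries.pderiv K s F) := by
          rw [← hF, ← mul_assoc, MvPowerSeries.inv_mul_cancel _ hc, one_mul]
        rw [this]
        exact (h1.mul_left _).mul_left _
      rw [MvPowerSeries.X_pow_dvd_iff] at h2 ih ⊢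
      intro m hm
      by_cases hm0 : m t = 0
      · exact ih m (by omega)
      obtain ⟨e, rfl⟩ : ∃ e, m = e + Finsupp.single t 1 :=
        ⟨m - Finsupp.single t 1, (tsub_add_cancel_of_le (by
          rw [Finsupp.single_le_iff]; omega)).symm⟩
      have h3 := h2 e (by simpa using hm)
      rw [MvPowerSeries.coeff_pderiv] at h3
      exact (mul_eq_zero.1 h3).resolve_right (Nat.cast_add_one_ne_zero _)
  ext m
  exact MvPowerSeries.X_pow_dvd_iff.1 (hdvd (m t)) m (Nat.lt_succ_self _)

end General

end StdCycle

namespace StdCycle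

/-! ### From `K[[x]][[y]]` to series in two variables -/

section Bivariate

variable {K : Type*} [Field K]

/-- The exponent of `x^u y^v`. -/
noncomputable def biexp (u v : ℕ) : Fin 2 →₀ ℕ := Finsupp.single 0 u + Finsupp.single 1 v

@[simp] theorem biexp_zero (u v : ℕ) : biexp u v 0 = u := by simp [biexp]

@[simp] theorem biexp_one (u v : ℕ) : biexp u v 1 = v := by simp [biexp]

theorem eq_biexp (d : Fin 2 →₀ ℕ) : d = biexp (d 0) (d 1) := by
  ext i; fin_cases i <;> simp

theorem biexp_add (u v u' v' : ℕ) : biexp u v + biexp u' v' = biexp (u + u') (v + v') := by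
  ext i; fin_cases i <;> simp

theorem coeff_biexp_mul (A B : MvPowerSeries (Fin 2) K) (u v : ℕ) :
    MvPowerSeries.coeff (biexp u v) (A * B) = ∑ a ∈ antidiagonal u, ∑ c ∈ antidiagonal v,
      MvPowerSeries.coeff (biexp a.1 c.1) A * MvPowerSeries.coeff (biexp a.2 c.2) B := by
  rw [MvPowerSeries.coeff_mul, ← Finset.sum_product']
  symm
  refine Finset.sum_bij' (fun p _ => (biexp p.1.1 p.2.1, biexp p.1.2 p.2.2))
    (fun p _ => ((p.1 0, p.2 0), (p.1 1, p.2 1))) ?_ ?_ ?_ ?_ ?_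
  · rintro ⟨⟨a, b⟩, ⟨c, d⟩⟩ h
    simp only [mem_product, HasAntidiagonal.mem_antidiagonal] at h ⊢
    rw [biexp_add, h.1, h.2]
  · rintro ⟨p, q⟩ h
    rw [HasAntidiagonal.mem_antidiagonal] at h
    simp only at h
    simp [← Finsupp.add_apply, h]
  · rintro ⟨⟨a, b⟩, ⟨c, d⟩⟩ h
    simp
  · rintro ⟨p, q⟩ h
    simp [← eq_biexp]
  · intros; rfl

/-- An element of `K[[x]][[y]]` as a series in the variables `x = X 0` and `y = X 1`. -/
noncomputable def toMv (G : K⟦X⟧⟦X⟧) : MvPowerSeries (Fin 2) K :=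
  fun d => coeff (d 0) (coeff (d 1) G)

theorem coeff_toMv (G : K⟦X⟧⟦X⟧) (d : Fin 2 →₀ ℕ) :
    MvPowerSeries.coeff d (toMv G) = coeff (d 0) (coeff (d 1) G) := rfl

theorem toMv_mul (A B : K⟦X⟧⟦X⟧) : toMv (A * B) = toMv A * toMv B := by
  ext d
  rw [eq_biexp d, coeff_biexp_mul, coeff_toMv]
  simp only [coeff_toMv, biexp_zero, biexp_one]
  rw [coeff_mul, map_sum, sum_comm]
  exact Finset.sum_congr rfl fun c _ => coeff_mul _ _ _

theorem toMv_inX (h : K⟦X⟧) : toMv (inX h) = h.subst (MvPowerSeries.X 0) := by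
  ext d
  have e0 : d = Finsupp.single 0 (d 0) ↔ d 1 = 0 := by
    simp [Finsupp.ext_iff, Fin.forall_fin_two]
  rw [coeff_subst_single, coeff_toMv, inX, coeff_C]
  simp only [e0]
  split_ifs <;> simp

theorem toMv_inY (h : K⟦X⟧) : toMv (inY h) = h.subst (MvPowerSeries.X 1) := by
  ext d
  have e1 : d = Finsupp.single 1 (d 1) ↔ d 0 = 0 := by
    simp [Finsupp.ext_iff, Fin.forall_fin_two]
  rw [coeff_subst_single, coeff_toMv, inY, coeff_map, coeff_C]
  simp only [e1]

theorem toMv_partialX (G : K⟦X⟧⟦X⟧) :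
    toMv (partialX G) = MvPowerSeries.pderiv K 0 (toMv G) := by
  ext d
  rw [MvPowerSeries.coeff_pderiv, coeff_toMv, coeff_toMv, partialX, coeff_mk, coeff_derivative]
  simp

theorem toMv_partialY (G : K⟦X⟧⟦X⟧) :
    toMv (partialY G) = MvPowerSeries.pderiv K 1 (toMv G) := by
  ext d
  rw [MvPowerSeries.coeff_pderiv, coeff_toMv, coeff_toMv, partialY, coeff_derivative]
  have : ((d 1 : K⟦X⟧) + 1) = C ((d 1 : K) + 1) := by simp
  rw [this, coeff_mul_C]
  simp

/-- The recursion for `p_{uv}^w` is the Cauchy product for `G * G^(w-1)`. -/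
theorem pCoeff_eq_coeff_pow (G : K⟦X⟧⟦X⟧) (w u v : ℕ) :
    pCoeff G w u v = MvPowerSeries.coeff (biexp u v) (toMv G ^ w) := by
  induction w using Nat.twoStepInduction generalizing u v with
  | zero =>
    classical
    rw [pCoeff, pow_zero, MvPowerSeries.coeff_one]
    refine if_congr ?_ rfl rfl
    simp [Finsupp.ext_iff, Fin.forall_fin_two]
  | one => simp [pCoeff, coeff_toMv]
  | more w _ ih =>
    rw [pCoeff, pow_succ', coeff_biexp_mul]
    refine Finset.sum_congr rfl fun a _ => Finset.sum_congr rfl fun c _ => ?_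
    rw [ih, coeff_toMv, biexp_zero, biexp_one]

end Bivariate

/-! ### The functional equation of `G` -/

section Solution

variable {K : Type*} [Field K]

theorem IsAdmissible.constantCoeff_eq_one {v₀ : ℕ} {f : K⟦X⟧} (h : IsAdmissible v₀ f) :
    constantCoeff f = 1 := by
  rw [← coeff_zero_eq_constantCoeff_apply, h.coeff_zero]

/-- `f⁻ᵛ - 1 = X ^ v * U` with `U(0) ≠ 0`. -/
theorem IsAdmissible.exists_inv_pow_factor [CharZero K] {v₀ : ℕ} {f : K⟦X⟧}
    (h : IsAdmissible v₀ f) :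
    ∃ U : K⟦X⟧, constantCoeff U ≠ 0 ∧ f⁻¹ ^ v₀ - 1 = X ^ v₀ * U := by
  obtain ⟨u, hu, hf⟩ := h.exists_factor
  have hf1 := h.constantCoeff_eq_one
  have hinv : f⁻¹ * f = 1 := PowerSeries.inv_mul_cancel _ (by rw [hf1]; exact one_ne_zero)
  have hS := geom_sum_mul f⁻¹ v₀
  have hSc : constantCoeff (∑ i ∈ range v₀, f⁻¹ ^ i) = (v₀ : K) := by
    simp [map_sum, hf1]
  -- The witness comes from `f⁻ᵛ - 1 = (f⁻¹ - 1) ∑ f⁻ⁱ` and `f⁻¹ - 1 = -f⁻¹ (f - 1)`; its constant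
  -- coefficient is `-v₀`.
  refine ⟨-(u * f⁻¹ * ∑ i ∈ range v₀, f⁻¹ ^ i), ?_, ?_⟩
  · rw [map_neg, map_mul, map_mul, hSc, hu, constantCoeff_inv, hf1]
    simp [h.pos.ne']
  · rw [← hS]
    linear_combination (∑ i ∈ range v₀, f⁻¹ ^ i) * hinv -
      (∑ i ∈ range v₀, f⁻¹ ^ i) * f⁻¹ * hf

/-- The order of `f'` is `v₀ - 1`, while `X ^ v₀` divides `f ^ v₀ - 1`. The vanishing of `g(0)` is
what makes `x` divide `G`. -/
theorem IsAdmissible.constantCoeff_quotient [CharZero K] {v₀ : ℕ} {f g : K⟦X⟧}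
    (h : IsAdmissible v₀ f) (hg : IsQuotient v₀ f g) : constantCoeff g = 0 := by
  obtain ⟨u, hu, hf⟩ := h.exists_factor
  obtain ⟨n, rfl⟩ : ∃ n, v₀ = n + 1 := ⟨v₀ - 1, by have := h.pos; omega⟩
  have hder : d⁄dX K f = X ^ n * (((n + 1 : ℕ) : K⟦X⟧) * u + X * d⁄dX K u) := by
    rw [hf, map_add, Derivation.leibniz, Derivation.leibniz_pow]
    simp only [Derivation.map_one_eq_zero, smul_eq_mul, nsmul_eq_mul,
      PowerSeries.derivative_X, Nat.add_sub_cancel]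
    ring
  obtain ⟨q, hq⟩ : f - 1 ∣ f ^ (n + 1) - 1 := by simpa using sub_dvd_pow_sub_pow f 1 (n + 1)
  have h1 : g * (((n + 1 : ℕ) : K⟦X⟧) * u + X * d⁄dX K u) = X * (u * f * q) := by
    have hX : (X : K⟦X⟧) ^ n ≠ 0 := pow_ne_zero _ X_ne_zero
    refine mul_left_cancel₀ hX ?_
    have hg' : g * d⁄dX K f = f * (f ^ (n + 1) - 1) := hg
    rw [hder, hq] at hg'
    linear_combination hg' + f * q * hf
  have h2 := congrArg constantCoeff h1
  simp only [map_add, map_mul, map_natCast, hu, constantCoeff_X, zero_mul, add_zero,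
    mul_one] at h2
  exact (mul_eq_zero.1 h2).resolve_right (by exact_mod_cast Nat.succ_ne_zero n)

/-- `g Q' = v Q` for `Q = f⁻ᵛ - 1`. -/
theorem IsAdmissible.quotient_mul_derivative {v₀ : ℕ} {f g : K⟦X⟧}
    (h : IsAdmissible v₀ f) (hg : IsQuotient v₀ f g) :
    g * d⁄dX K (f⁻¹ ^ v₀ - 1) = v₀ * (f⁻¹ ^ v₀ - 1) := by
  have hinv : f⁻¹ * f = 1 :=
    PowerSeries.inv_mul_cancel _ (by rw [h.constantCoeff_eq_one]; exact one_ne_zero)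
  have hpow : f⁻¹ ^ v₀ * f ^ v₀ = 1 := by rw [← mul_pow, hinv, one_pow]
  obtain ⟨n, rfl⟩ : ∃ n, v₀ = n + 1 := ⟨v₀ - 1, by have := h.pos; omega⟩
  have hg' : g * d⁄dX K f = f * (f ^ (n + 1) - 1) := hg
  rw [map_sub, derivative_pow, derivative_inv', Derivation.map_one_eq_zero, sub_zero,
    Nat.add_sub_cancel]
  linear_combination (-((n + 1 : ℕ) : K⟦X⟧) * f⁻¹ ^ (n + 2)) * hg' -
    ((n + 1 : ℕ) : K⟦X⟧) * f⁻¹ ^ (n + 1) * (f ^ (n + 1) - 1) * hinv -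
    ((n + 1 : ℕ) : K⟦X⟧) * hpow

variable {f g : K⟦X⟧} {G : K⟦X⟧⟦X⟧}

theorem IsSolution.toMv_pde (h : IsSolution f g G) :
    f.subst (MvPowerSeries.X 1 : MvPowerSeries (Fin 2) K) * MvPowerSeries.pderiv K 1 (toMv G) =
      g.subst (MvPowerSeries.X 0 : MvPowerSeries (Fin 2) K) *
        (d⁄dX K f).subst (MvPowerSeries.X 1 : MvPowerSeries (Fin 2) K) *
        MvPowerSeries.pderiv K 0 (toMv G) := by
  have hs : inY (f - 1) = inY f - 1 := by simp [inY]
  have hp : inY f * partialY G = inX g * inY (d⁄dX K f) * partialX G := by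
    have := h.pde
    rw [hs] at this
    linear_combination this
  simpa only [toMv_mul, toMv_inX, toMv_inY, toMv_partialX, toMv_partialY] using congrArg toMv hp

theorem IsSolution.X_one_dvd (h : IsSolution f g G) :
    (MvPowerSeries.X 1 : MvPowerSeries (Fin 2) K) ∣ toMv G - MvPowerSeries.X 0 := by
  classical
  rw [MvPowerSeries.X_dvd_iff]
  intro m hm
  rw [map_sub, coeff_toMv, hm, h.initial, coeff_X, MvPowerSeries.coeff_X, sub_eq_zero]
  refine if_congr ?_ rfl rfl
  simp [Finsupp.ext_iff, Fin.forall_fin_two, hm]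

/-- `G(0, y) = 0` if `f` is a unit and `g(0) = 0`. -/
theorem IsSolution.map_constantCoeff [CharZero K] (h : IsSolution f g G)
    (hf : constantCoeff f ≠ 0) (hg : constantCoeff g = 0) :
    PowerSeries.map (constantCoeff : K⟦X⟧ →+* K) G = 0 := by
  set G₀ := PowerSeries.map (constantCoeff : K⟦X⟧ →+* K) G with hG₀
  have hY : ∀ q : K⟦X⟧, PowerSeries.map (constantCoeff : K⟦X⟧ →+* K) (inY q) = q := by
    intro q; ext n; simp [inY]
  have hD : PowerSeries.map (constantCoeff : K⟦X⟧ →+* K) (partialY G) = d⁄dX K G₀ := by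
    ext n; simp [partialY, coeff_derivative, hG₀]
  -- At `x = 0` the term with `g` drops out, and the equation collapses to `f G₀' = 0`.
  have hp := congrArg (PowerSeries.map (constantCoeff : K⟦X⟧ →+* K)) h.pde
  rw [map_sub, map_mul, map_mul, map_mul, hY, hY, hD, inX, map_C, hg, map_zero, zero_mul,
    zero_mul] at hp
  have h1 : f * d⁄dX K G₀ = 0 := by linear_combination hp
  have h2 : d⁄dX K G₀ = 0 :=
    (mul_eq_zero.1 h1).resolve_left (by rintro rfl; simp at hf)
  refine derivative.ext (by rw [h2, map_zero]) ?_
  rw [map_zero, ← coeff_zero_eq_constantCoeff_apply, hG₀, coeff_map, h.initial, constantCoeff_X]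

/-- Divisibility by `x` is `G(0, y) = 0`, and the constant coefficient of the quotient is read off
from `G(x, 0) = x`. The first bounds the sums in `E_{ijk}`; the second selects the branch when `Q`
is cancelled. -/
theorem IsSolution.exists_factor [CharZero K] (h : IsSolution f g G)
    (hf : constantCoeff f ≠ 0) (hg : constantCoeff g = 0) :
    ∃ H : MvPowerSeries (Fin 2) K, MvPowerSeries.constantCoeff H = 1 ∧
      toMv G = MvPowerSeries.X 0 * H := by
  have hd : (MvPowerSeries.X 0 : MvPowerSeries (Fin 2) K) ∣ toMv G := by
    rw [MvPowerSeries.X_dvd_iff]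
    intro m hm
    have := congrArg (coeff (m 1)) (h.map_constantCoeff hf hg)
    rw [coeff_map, map_zero] at this
    rw [coeff_toMv, hm, coeff_zero_eq_constantCoeff_apply, this]
  obtain ⟨H, hH⟩ := hd
  refine ⟨H, ?_, hH⟩
  rw [← MvPowerSeries.coeff_zero_eq_constantCoeff_apply, ← coeff_add_single_X_mul 0 0 H, ← hH,
    coeff_toMv]
  simp [h.initial]

/-- `Q(G(x, y)) = f(y)^v Q(x)` for `Q = f⁻ᵛ - 1`. -/
theorem IsSolution.subst_toMv [CharZero K] {v₀ : ℕ} (hf : IsAdmissible v₀ f)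
    (hg : IsQuotient v₀ f g) (h : IsSolution f g G) :
    (f⁻¹ ^ v₀ - 1).subst (toMv G) =
      f.subst (MvPowerSeries.X 1 : MvPowerSeries (Fin 2) K) ^ v₀ *
        (f⁻¹ ^ v₀ - 1).subst (MvPowerSeries.X 0 : MvPowerSeries (Fin 2) K) := by
  have hf1 := hf.constantCoeff_eq_one
  have hf0 : constantCoeff f ≠ 0 := by rw [hf1]; exact one_ne_zero
  obtain ⟨H, -, hH⟩ := h.exists_factor hf0 (hf.constantCoeff_quotient hg)
  have hG : MvPowerSeries.constantCoeff (toMv G) = 0 := by simp [hH]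
  have hX : ∀ s, MvPowerSeries.constantCoeff (MvPowerSeries.X s : MvPowerSeries (Fin 2) K) = 0 :=
    fun s => MvPowerSeries.constantCoeff_X s
  have hode := congrArg (PowerSeries.subst (MvPowerSeries.X 0 : MvPowerSeries (Fin 2) K))
    (hf.quotient_mul_derivative hg)
  have hpde := h.toMv_pde
  obtain ⟨Z, hZ⟩ : MvPowerSeries.X 1 ∣ (f⁻¹ ^ v₀ - 1).subst (toMv G) -
      (f⁻¹ ^ v₀ - 1).subst (MvPowerSeries.X 0 : MvPowerSeries (Fin 2) K) :=
    h.X_one_dvd.trans (sub_dvd_subst_sub_subst _ hG (hX 0))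
  generalize f⁻¹ ^ v₀ - 1 = Q at *
  rw [subst_mul (HasSubst.X 0), subst_mul (HasSubst.X 0), ← map_natCast (C : K →+* K⟦X⟧) v₀,
    subst_C, map_natCast] at hode
  have hf1' : MvPowerSeries.X 1 ∣ f.subst (MvPowerSeries.X 1 : MvPowerSeries (Fin 2) K) ^ v₀ - 1 := by
    have h0 := sub_dvd_subst_sub_subst f (hX 1) (map_zero MvPowerSeries.constantCoeff)
    rw [sub_zero, subst_zero_eq_C_constantCoeff, hf1] at h0
    simpa using h0.trans (sub_dvd_pow_sub_pow _ _ v₀)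
  rw [← sub_eq_zero]
  -- The difference of the two sides satisfies `f(y) F_y = g(x) f'(y) F_x`: for `Q(G)` by the chain
  -- rule, for `f(y)ᵛ Q(x)` by `g Q' = v Q`. It vanishes at `y = 0`, where `G = x` and `f = 1`.
  refine eq_zero_of_pderiv_eq (s := 0) (t := 1) (by simp)
    (c := f.subst (MvPowerSeries.X 1 : MvPowerSeries (Fin 2) K))
    (b := g.subst (MvPowerSeries.X 0 : MvPowerSeries (Fin 2) K) *
        (d⁄dX K f).subst (MvPowerSeries.X 1 : MvPowerSeries (Fin 2) K))
    (by rwa [constantCoeff_powerSeries_subst (hX 1)]) ?_ ?_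
  · obtain ⟨n, rfl⟩ : ∃ n, v₀ = n + 1 := ⟨v₀ - 1, by have := hf.pos; omega⟩
    simp only [map_sub, Derivation.leibniz, smul_eq_mul, MvPowerSeries.pderiv_pow,
      pderiv_subst _ _ (hX _), pderiv_subst _ _ hG, MvPowerSeries.pderiv_X_self,
      MvPowerSeries.pderiv_X_of_ne (show (0 : Fin 2) ≠ 1 by simp),
      MvPowerSeries.pderiv_X_of_ne (show (1 : Fin 2) ≠ 0 by simp), Nat.add_sub_cancel]
    linear_combination (d⁄dX K Q).subst (toMv G) * hpde +
      f.subst (MvPowerSeries.X 1 : MvPowerSeries (Fin 2) K) ^ (n + 1) *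
        (d⁄dX K f).subst (MvPowerSeries.X 1 : MvPowerSeries (Fin 2) K) * hode
  · obtain ⟨Z', hZ'⟩ := hf1'
    exact ⟨Z - Z' * Q.subst (MvPowerSeries.X 0 : MvPowerSeries (Fin 2) K), by
      linear_combination hZ - Q.subst (MvPowerSeries.X 0 : MvPowerSeries (Fin 2) K) * hZ'⟩

end Solution

end StdCycle

namespace StdCycle

/-! ### Three variables: the iterates of `G` and their symmetry -/

section Trivariate

variable {K : Type*} [Field K] {σ τ : Type*}

theorem hasSubst_pair {a b : MvPowerSeries τ K} (ha : MvPowerSeries.constantCoeff a = 0)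
    (hb : MvPowerSeries.constantCoeff b = 0) : MvPowerSeries.HasSubst ![a, b] :=
  MvPowerSeries.hasSubst_of_constantCoeff_zero fun s => by fin_cases s <;> simp [ha, hb]

theorem coeff_subst_X_pair {p q : σ} (hpq : p ≠ q) (P : MvPowerSeries (Fin 2) K) (e : σ →₀ ℕ) :
    open Classical in
    MvPowerSeries.coeff e (P.subst ![MvPowerSeries.X p, MvPowerSeries.X q]) =
      if e = Finsupp.single p (e p) + Finsupp.single q (e q) then
        MvPowerSeries.coeff (biexp (e p) (e q)) P else 0 := by
  classical
  have hprod : ∀ d : Fin 2 →₀ ℕ, MvPowerSeries.coeff e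
      (d.prod fun s n => (![MvPowerSeries.X p, MvPowerSeries.X q] s : MvPowerSeries σ K) ^ n) =
      if e = Finsupp.single p (d 0) + Finsupp.single q (d 1) then 1 else 0 := by
    intro d
    rw [Finsupp.prod_pow, Fin.prod_univ_two]
    simp [MvPowerSeries.X_pow_eq, MvPowerSeries.monomial_mul_monomial,
      MvPowerSeries.coeff_monomial]
  rw [MvPowerSeries.coeff_subst MvPowerSeries.HasSubst.X_X,
    finsum_eq_single _ (biexp (e p) (e q))]
  · rw [hprod, biexp_zero, biexp_one]
    split_ifs <;> simp
  · intro d hd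
    rw [hprod, if_neg, smul_zero]
    intro he
    apply hd
    rw [eq_biexp d, he]
    simp [hpq, hpq.symm]

/-- The first factor is free of `r` and the second of `p`, so the exponents `i` and `k` are forced
and only `j` can be shared out. -/
theorem coeff_subst_mul_subst {p q r : σ} (hpq : p ≠ q) (hqr : q ≠ r) (hpr : p ≠ r)
    (P Q : MvPowerSeries (Fin 2) K) (i j k : ℕ) :
    MvPowerSeries.coeff (Finsupp.single p i + Finsupp.single q j + Finsupp.single r k)
      (P.subst ![MvPowerSeries.X p, MvPowerSeries.X q] *
        Q.subst ![MvPowerSeries.X r, MvPowerSeries.X q]) =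
      ∑ ab ∈ antidiagonal j, MvPowerSeries.coeff (biexp i ab.1) P *
        MvPowerSeries.coeff (biexp k ab.2) Q := by
  classical
  rw [MvPowerSeries.coeff_mul]
  symm
  refine Finset.sum_of_injOn (fun ab => (Finsupp.single p i + Finsupp.single q ab.1,
    Finsupp.single r k + Finsupp.single q ab.2)) ?_ ?_ ?_ ?_
  · rintro ⟨a, b⟩ - ⟨a', b'⟩ - h
    simpa [Finsupp.single_left_inj, (Finsupp.single_injective q).eq_iff] using h
  · rintro ⟨a, b⟩ h
    have h' : a + b = j := by simpa using h
    simp only [← h', Finsupp.single_add, mem_coe,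
      HasAntidiagonal.mem_antidiagonal]
    abel
  · rintro ⟨x, y⟩ hxy hn
    rw [HasAntidiagonal.mem_antidiagonal] at hxy
    simp only at hxy ⊢
    rw [coeff_subst_X_pair hpq, coeff_subst_X_pair hqr.symm]
    split_ifs with hx hy
    · exfalso
      apply hn
      have hp := DFunLike.congr_fun hxy p
      have hq := DFunLike.congr_fun hxy q
      have hr := DFunLike.congr_fun hxy r
      have hxr := DFunLike.congr_fun hx r
      have hyp := DFunLike.congr_fun hy p
      simp [hpq, hqr, hpr, hpq.symm, hqr.symm, hpr.symm] at hp hq hr hxr hyp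
      refine ⟨(x q, y q), by simpa using hq, ?_⟩
      have hp' : x p = i := by omega
      have hr' : y r = k := by omega
      simp only [← hp', ← hr', ← hx, ← hy]
    all_goals simp
  · rintro ⟨a, b⟩ -
    simp only
    rw [coeff_subst_X_pair hpq, coeff_subst_X_pair hqr.symm, if_pos, if_pos]
    · simp [hpq, hqr, hpq.symm, hqr.symm]
    · simp [hqr, hqr.symm]
    · simp [hpq, hpq.symm]

variable {G : K⟦X⟧⟦X⟧}

/-- The coefficients of `G(G(x, y), G(z, y))`. -/
theorem coeff_subst_subst {H : MvPowerSeries (Fin 2) K}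
    (hH : toMv G = MvPowerSeries.X 0 * H) {p q r : σ} (hpq : p ≠ q) (hqr : q ≠ r) (hpr : p ≠ r)
    (i j k : ℕ) :
    MvPowerSeries.coeff (Finsupp.single p i + Finsupp.single q j + Finsupp.single r k)
      ((toMv G).subst ![(toMv G).subst ![MvPowerSeries.X p, MvPowerSeries.X q],
        (toMv G).subst ![MvPowerSeries.X r, MvPowerSeries.X q]]) =
      ∑ ab ∈ antidiagonal j, ∑ h ∈ range (i + 1), ∑ l ∈ range (k + 1),
        pCoeff G h i ab.1 * pCoeff G l k ab.2 * pCoeff G 1 h l := by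
  have h0 : MvPowerSeries.constantCoeff (toMv G) = 0 := by simp [hH]
  have hc : ∀ s t : σ, MvPowerSeries.constantCoeff ((toMv G).subst
      ![(MvPowerSeries.X s : MvPowerSeries σ K), MvPowerSeries.X t]) = 0 := fun s t => by
    rw [constantCoeff_subst_eq (fun u => by fin_cases u <;> simp), h0]
  -- Since `x^w` divides `G^w`, only `h ≤ i` and `l ≤ k` contribute to the a priori infinite sum of
  -- the substitution.
  have hvan : ∀ w u v, u < w → pCoeff G w u v = 0 := by
    intro w u v huw
    rw [pCoeff_eq_coeff_pow, hH, mul_pow]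
    exact MvPowerSeries.X_pow_dvd_iff.1 (Dvd.intro _ rfl) _ (by simpa using huw)
  have hterm : ∀ d : Fin 2 →₀ ℕ, MvPowerSeries.coeff d (toMv G) • MvPowerSeries.coeff
      (Finsupp.single p i + Finsupp.single q j + Finsupp.single r k)
      (d.prod fun s n => (![(toMv G).subst ![(MvPowerSeries.X p : MvPowerSeries σ K),
          MvPowerSeries.X q],
        (toMv G).subst ![MvPowerSeries.X r, MvPowerSeries.X q]] s) ^ n) =
      ∑ ab ∈ antidiagonal j,
        pCoeff G (d 0) i ab.1 * pCoeff G (d 1) k ab.2 * pCoeff G 1 (d 0) (d 1) := by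
    intro d
    rw [Finsupp.prod_pow, Fin.prod_univ_two]
    simp only [Matrix.cons_val_zero, Matrix.cons_val_one]
    rw [← MvPowerSeries.subst_pow MvPowerSeries.HasSubst.X_X,
      ← MvPowerSeries.subst_pow MvPowerSeries.HasSubst.X_X,
      coeff_subst_mul_subst hpq hqr hpr, smul_eq_mul, mul_comm, Finset.sum_mul]
    refine Finset.sum_congr rfl fun ab _ => ?_
    rw [pCoeff_eq_coeff_pow, pCoeff_eq_coeff_pow, pCoeff_eq_coeff_pow, pow_one, ← eq_biexp]
  rw [MvPowerSeries.coeff_subst (hasSubst_pair (hc p q) (hc r q)), finsum_congr hterm,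
    finsum_eq_sum_of_support_subset (s := (range (i + 1) ×ˢ range (k + 1)).image
      fun hl => biexp hl.1 hl.2), Finset.sum_image, sum_comm]
  · refine Finset.sum_congr rfl fun ab _ => ?_
    rw [Finset.sum_product]
    simp
  · intro x _ y _ hxy
    exact Prod.ext (by simpa using DFunLike.congr_fun hxy 0)
      (by simpa using DFunLike.congr_fun hxy 1)
  · intro d hd
    simp only [coe_image, Set.mem_image, mem_coe]
    refine ⟨(d 0, d 1), ?_, (eq_biexp d).symm⟩
    by_contra hn
    refine hd (Finset.sum_eq_zero fun ab _ => ?_)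
    simp only [mem_product, mem_range, not_and_or, not_lt] at hn
    rcases hn with hn | hn
    · rw [hvan (d 0) _ _ (by omega), zero_mul, zero_mul]
    · rw [hvan (d 1) _ _ (by omega), mul_zero, zero_mul]

variable {f g : K⟦X⟧} [CharZero K]

/-- `Q(G(a, b)) = f(b)^v Q(a)` for `Q = f⁻ᵛ - 1`. -/
theorem IsSolution.subst_subst {v₀ : ℕ} (hf : IsAdmissible v₀ f) (hg : IsQuotient v₀ f g)
    (h : IsSolution f g G) {a b : MvPowerSeries τ K} (ha : MvPowerSeries.constantCoeff a = 0)
    (hb : MvPowerSeries.constantCoeff b = 0) :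
    (f⁻¹ ^ v₀ - 1).subst ((toMv G).subst ![a, b]) =
      f.subst b ^ v₀ * (f⁻¹ ^ v₀ - 1).subst a := by
  have hab := hasSubst_pair ha hb
  obtain ⟨H, -, hH⟩ := h.exists_factor (by rw [hf.constantCoeff_eq_one]; exact one_ne_zero)
    (hf.constantCoeff_quotient hg)
  have hG : HasSubst (toMv G) := HasSubst.of_constantCoeff_zero (by simp [hH])
  have hc : ∀ (ψ : K⟦X⟧) (c : MvPowerSeries (Fin 2) K), HasSubst c →
      (ψ.subst c).subst ![a, b] = ψ.subst (c.subst ![a, b]) := fun ψ c hc => by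
    rw [PowerSeries.subst, MvPowerSeries.subst_comp_subst_apply hc.const hab, PowerSeries.subst]
  have := congrArg (MvPowerSeries.subst ![a, b]) (h.subst_toMv hf hg)
  rw [MvPowerSeries.subst_mul hab, MvPowerSeries.subst_pow hab, hc _ _ hG, hc _ _ (HasSubst.X _),
    hc _ _ (HasSubst.X _), MvPowerSeries.subst_X hab, MvPowerSeries.subst_X hab] at this
  exact this

/-- The identity `G(G(x, y), G(z, y)) = G(G(x, z), G(y, z))`. -/
theorem IsSolution.subst_subst_comm {v₀ : ℕ} (hf : IsAdmissible v₀ f) (hg : IsQuotient v₀ f g)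
    (h : IsSolution f g G) (p q r : σ) :
    (toMv G).subst ![(toMv G).subst ![(MvPowerSeries.X p : MvPowerSeries σ K), MvPowerSeries.X q],
        (toMv G).subst ![MvPowerSeries.X r, MvPowerSeries.X q]] =
      (toMv G).subst ![(toMv G).subst ![(MvPowerSeries.X p : MvPowerSeries σ K),
          MvPowerSeries.X r],
        (toMv G).subst ![MvPowerSeries.X q, MvPowerSeries.X r]] := by
  have hf1 := hf.constantCoeff_eq_one
  obtain ⟨H, hH1, hH⟩ := h.exists_factor (by rw [hf1]; exact one_ne_zero)
    (hf.constantCoeff_quotient hg)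
  obtain ⟨U, hU, hQU⟩ := hf.exists_inv_pow_factor
  have h0 : MvPowerSeries.constantCoeff (toMv G) = 0 := by simp [hH]
  have hX : ∀ s, MvPowerSeries.constantCoeff (MvPowerSeries.X s : MvPowerSeries σ K) = 0 :=
    fun s => MvPowerSeries.constantCoeff_X s
  have hc : ∀ s t : σ, MvPowerSeries.constantCoeff ((toMv G).subst
      ![(MvPowerSeries.X s : MvPowerSeries σ K), MvPowerSeries.X t]) = 0 := fun s t => by
    rw [constantCoeff_subst_eq (fun u => by fin_cases u <;> simp), h0]
  have hfac : ∀ a b : MvPowerSeries σ K, MvPowerSeries.constantCoeff a = 0 →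
      MvPowerSeries.constantCoeff b = 0 →
      MvPowerSeries.constantCoeff (H.subst ![a, b]) = 1 ∧
        (toMv G).subst ![a, b] = a * H.subst ![a, b] := by
    intro a b ha hb
    constructor
    · rw [constantCoeff_subst_eq (fun u => by fin_cases u <;> simp [ha, hb]), hH1]
    · rw [hH, MvPowerSeries.subst_mul (hasSubst_pair ha hb),
        MvPowerSeries.subst_X (hasSubst_pair ha hb), Matrix.cons_val_zero]
  have hfac₂ : ∀ q r : σ, ∃ A : MvPowerSeries σ K, MvPowerSeries.constantCoeff A = 1 ∧
      (toMv G).subst ![(toMv G).subst ![(MvPowerSeries.X p : MvPowerSeries σ K),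
        MvPowerSeries.X q], (toMv G).subst ![MvPowerSeries.X r, MvPowerSeries.X q]] =
        MvPowerSeries.X p * A := by
    intro q r
    obtain ⟨h1, h2⟩ := hfac _ _ (hX p) (hX q)
    obtain ⟨h3, h4⟩ := hfac _ _ (hc p q) (hc r q)
    refine ⟨_, ?_, h4.trans ((congrArg (· * _) h2).trans (mul_assoc _ _ _))⟩
    rw [map_mul, h1, h3, one_mul]
  obtain ⟨A, hA, hLA⟩ := hfac₂ q r
  obtain ⟨B, hB, hRB⟩ := hfac₂ r q
  -- Both values equal `Q(x) / (1 + Q(y) + Q(z))`, where `x`, `y`, `z` are the variables `p`, `q`,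
  -- `r`.
  have hval : (f⁻¹ ^ v₀ - 1).subst ((toMv G).subst
      ![(toMv G).subst ![(MvPowerSeries.X p : MvPowerSeries σ K), MvPowerSeries.X q],
        (toMv G).subst ![MvPowerSeries.X r, MvPowerSeries.X q]]) =
      (f⁻¹ ^ v₀ - 1).subst ((toMv G).subst
      ![(toMv G).subst ![(MvPowerSeries.X p : MvPowerSeries σ K), MvPowerSeries.X r],
        (toMv G).subst ![MvPowerSeries.X q, MvPowerSeries.X r]]) := by
    have hunit : ∀ a : MvPowerSeries σ K, MvPowerSeries.constantCoeff a = 0 →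
        f.subst a ^ v₀ * (1 + (f⁻¹ ^ v₀ - 1).subst a) = 1 := by
      intro a ha
      have hs := HasSubst.of_constantCoeff_zero ha
      have h1 : (1 : K⟦X⟧).subst a = 1 := by
        rw [← map_one (C : K →+* K⟦X⟧), subst_C, map_one]
      rw [subst_sub hs, h1, add_sub_cancel, ← subst_pow hs, ← subst_mul hs, ← mul_pow,
        PowerSeries.mul_inv_cancel _ (by rw [hf1]; exact one_ne_zero), one_pow, h1]
    have u1 := hunit _ (hc r q)
    have u2 := hunit _ (hc q r)
    have u3 := hunit _ (hX q)
    have u4 := hunit _ (hX r)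
    rw [h.subst_subst hf hg (hX _) (hX _)] at u1 u2
    rw [h.subst_subst hf hg (hc _ _) (hc _ _), h.subst_subst hf hg (hc _ _) (hc _ _),
      h.subst_subst hf hg (hX _) (hX _), h.subst_subst hf hg (hX _) (hX _)]
    generalize f.subst ((toMv G).subst
      ![(MvPowerSeries.X r : MvPowerSeries σ K), MvPowerSeries.X q]) ^ v₀ = s at *
    generalize f.subst ((toMv G).subst
      ![(MvPowerSeries.X q : MvPowerSeries σ K), MvPowerSeries.X r]) ^ v₀ = t at *
    generalize (f⁻¹ ^ v₀ - 1).subst (MvPowerSeries.X p : MvPowerSeries σ K) = x at *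
    generalize (f⁻¹ ^ v₀ - 1).subst (MvPowerSeries.X q : MvPowerSeries σ K) = y at *
    generalize (f⁻¹ ^ v₀ - 1).subst (MvPowerSeries.X r : MvPowerSeries σ K) = z at *
    generalize f.subst (MvPowerSeries.X q : MvPowerSeries σ K) ^ v₀ = b at *
    generalize f.subst (MvPowerSeries.X r : MvPowerSeries σ K) ^ v₀ = c at *
    -- The relations are `s (1 + b z) = 1`, `t (1 + c y) = 1`, `b (1 + y) = 1`, `c (1 + z) = 1`.
    -- Thus `s b` and `t c` are both inverse to `1 + y + z`; cross-multiplication avoids the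
    -- division.
    linear_combination x * (t * c * u1 - s * b * u2 + s * t * (c * u3 - b * u4))
  rw [hLA, hRB, hQU] at hval
  rw [hLA, hRB, eq_of_subst_eq hf.pos.ne' hU p hA hB hval]

end Trivariate

end StdCycle

theorem theorem3p2 {K : Type*} [Field K] [IsAlgClosed K] [CharZero K]
    {v₀ : ℕ} {f : PowerSeries K} (hf : StdCycle.IsAdmissible v₀ f) (i j k : ℕ) :
    StdCycle.BraidEquation (StdCycle.pCoeff (StdCycle.GSeries hf)) i j k := by
  have hg := StdCycle.gSeries_spec hf
  have h := StdCycle.GSeries_spec hf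
  obtain ⟨H, -, hH⟩ := h.exists_factor (by rw [hf.constantCoeff_eq_one]; exact one_ne_zero)
    (hf.constantCoeff_quotient hg)
  -- The right side of `E_{ijk}` is the left side with `j` and `k` exchanged, so it is read off with
  -- the variables `1` and `2` exchanged; `add_right_comm` matches the two monomials.
  rw [StdCycle.BraidEquation,
    ← StdCycle.coeff_subst_subst hH (show (0 : Fin 3) ≠ 1 by simp) (show (1 : Fin 3) ≠ 2 by simp)
      (show (0 : Fin 3) ≠ 2 by simp) i j k,
    ← StdCycle.coeff_subst_subst hH (show (0 : Fin 3) ≠ 2 by simp) (show (2 : Fin 3) ≠ 1 by simp)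
      (show (0 : Fin 3) ≠ 1 by simp) i k j,
    h.subst_subst_comm hf hg, add_right_comm]
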